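/- **Setting.** Let $T$ be a first-order theory in a language $L$, let $D$ be a set of complete types of $T$ over $\emptyset$ in finitely many variables (a *diagram*), let $\chi>|L|+\aleph_0$ be a cardinal, and let $\mathfrak C\models T$. A set $A\subseteq\mathfrak C$ is a *$D$-set* if every finite sequence from $A$ has its type over $\emptyset$ in $D$; $S_D(A)$ is the set of complete types $p$ over $A$ such that $A\cup\bar c$ is a $D$-set whenever $\bar c$ realizes $p$. Models are elementary submodels of $\mathfrak C$ (including $\mathfrak C$ itself); a model $M$ is *$(D,\lambda)$-homogeneous* if it is a $D$-set and realizes every $1$-type in $S_D(A)$ for every $A\subseteq M$ with $|A|<\lambda$. Assume that $\mathfrak C$ is $(D,\chi)$-homogeneous. **Rank.** For $A\subseteq\mathfrak C$ and a set of formulas $p(\bar x)$ with finitely many parameters, all in $A$, define $R_A[p]\ge\alpha$ by induction: $R_A[p]\ge 0$ iff $p$ is realized in $\mathfrak C$; for limit $\delta$, $R_A[p]\ge\delta$ iff $R_A[p]\ge\alpha$ for all $\alpha<\delta$; and $R_A[p]\ge\alpha+1$ iff (a) there is a formula $\phi(\bar x,\bar a)$ with $\bar a\in A$ such that $R_A[p\cup\{\phi\}]\ge\alpha$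 and $R_A[p\cup\{\neg\phi\}]\ge\alpha$, and (b) for every finite $\bar a\in A$ there is $q(\bar x,\bar y)\in D$ with $R_A[p\cup q(\bar x,\bar a)]\ge\alpha$. So $R_A[p]$ is $-1$, an ordinal or $\infty$. For arbitrary $p$ over $A$, $R_A[p]$ is the minimum of $R_A[q]$ over the $q\subseteq p$ with finitely many parameters. Write $R=R_{\mathfrak C}$. Assume that $D$ is *totally transcendental*: $R_A[p]<\infty$ for every $A\subseteq\mathfrak C$ and every $p$ over $A$. **Definitions.** A type $p$ is *stationary* if for every $B\subseteq\mathfrak C$ containing its parameters there is a unique $p_B\in S_D(B)$ with $p\subseteq p_B$ and $R[p_B]=R[p]$. A type $p\in S_D(A)$ is *big* if for every finite $B\subseteq A$ and every model $M\supseteq B$ with $|M|<\chi$, the restriction $p\restriction B$ is realized in $\mathfrak C$ outside $M$. Write $\bar a\perp_B E$ if $R[\operatorname{tp}(\bar a,B)]=R[\operatorname{tp}(\bar a,B\cup E)]$. A big stationary type $p\in S_D(A)$ is *regular* if for all $B\subseteq\mathfrak C$ and all $\bar a,\bar b$ in $\mathfrak C$ realizing $p$: if $\bar a\perp_A B$ and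 not $\bar b\perp_A B$, then $\bar a\perp_A B\cup\bar b$. **Theorem (existence of regular types).** Let $M\subsetneq N$ be $(D,\aleph_0)$-homogeneous models. Then there are a finite $\bar a\in M$ and a regular type $p(x,\bar a)\in S_D(\bar a)$, in one variable $x$, that is realized by an element of $N-M$. In fact, let $A\subseteq M$ and let $p(x)\in S_D(A)$ be a big stationary type realized in $N-M$, whose rank $R[p]$ is minimal among the ranks of all big stationary types $q(x)\in S_D(A')$, $A'\subseteq M$, that are realized in $N-M$. Then $p$ is regular. -/

import Mathlib

open FirstOrder FirstOrder.Language
open scoped Cardinal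

universe u v w

namespace Diagram

/-! Formulas with parameters. `C` is the ambient model. A formula `φ(x₀, …, xₙ₋₁)` with parameters
from `C` is an `L`-formula whose free variables are indexed by `C ⊕ Fin n`: the variable `inl c`
is the parameter `c`, and `inr i` is the variable `xᵢ`. -/

/-- `L`-formulas in the variables `x₀, …, xₙ₋₁`, with parameters from `C`. -/
abbrev PFormula (L : FirstOrder.Language.{u, v}) (C : Type w) (n : ℕ) : Type (max u v w) :=
  L.Formula (C ⊕ Fin n)

/-- A diagram: a set `D ⊆ D(T)` of complete types of `T` over the empty set, in finitely many
variables. -/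
abbrev Diag {L : FirstOrder.Language.{u, v}} (T : L.Theory) : Type (max u v) :=
  (n : ℕ) → Set (T.CompleteType (Fin n))

section Basic

variable {L : FirstOrder.Language.{u, v}} {C : Type w} {n : ℕ}

open Classical in
/-- The parameters occurring in a formula. -/
noncomputable def params (φ : PFormula L C n) : Set C :=
  {c | Sum.inl c ∈ BoundedFormula.freeVarFinset φ}

/-- The set `dom(p)` of the parameters occurring in the formulas of `p`. -/
def dom (p : Set (PFormula L C n)) : Set C :=
  {c | ∃ φ ∈ p, c ∈ params φ}

/-- `p ↾ B`: the formulas of `p` with all parameters in `B`. -/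
def restrict (p : Set (PFormula L C n)) (B : Set C) : Set (PFormula L C n) :=
  {φ | φ ∈ p ∧ params φ ⊆ B}

variable [L.Structure C]

/-- The tuple `c` of elements of `C` realizes the set of formulas `p`. -/
def Realizes (c : Fin n → C) (p : Set (PFormula L C n)) : Prop :=
  ∀ φ ∈ p, Formula.Realize φ (Sum.elim id c)

/-- `tp(c, A)`. -/
def tp (L : FirstOrder.Language.{u, v}) {C : Type w} [L.Structure C] {n : ℕ} (c : Fin n → C) (A : Set C) :
    Set (PFormula L C n) :=
  {φ | params φ ⊆ A ∧ Formula.Realize φ (Sum.elim id c)}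

/-- `p ∈ Sⁿ(A)`: `p` is a complete type over `A`, that is, a set of formulas over `A` that is
consistent with the elementary diagram of `C` (equivalently, every finite part of it is satisfied
in `C`) and that decides every formula over `A`. -/
def IsCompleteType (A : Set C) (p : Set (PFormula L C n)) : Prop :=
  (∀ φ ∈ p, params φ ⊆ A) ∧
  (∀ φ : PFormula L C n, params φ ⊆ A → φ ∈ p ∨ φ.not ∈ p) ∧
  (∀ s : Set (PFormula L C n), s ⊆ p → s.Finite → ∃ c : Fin n → C, Realizes c s)

end Basic

section Rank

variable {L : FirstOrder.Language.{u, v}} {T : L.Theory} {C : Type w}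

/-- `q(x, a)`: the result of replacing the last `m` variables of `q(x, y) ∈ D(T)` by the
parameters `a`. -/
def instType {n m : ℕ} (q : T.CompleteType (Fin (n + m))) (a : Fin m → C) :
    Set (PFormula L C n) :=
  {φ | ∃ ψ : L.Formula (Fin (n + m)), Formula.equivSentence ψ ∈ q ∧
    φ = ψ.relabel (Fin.append (fun i : Fin n => (Sum.inr i : C ⊕ Fin n)) (fun j => Sum.inl (a j)))}

variable [L.Structure C]

/-- `A` is a `D`-set: every finite sequence from `A` has its type over `∅` in `D`. -/
def IsDSet [C ⊨ T] [Nonempty C] (D : Diag T) (A : Set C) : Prop :=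
  ∀ (m : ℕ) (a : Fin m → C), (∀ i, a i ∈ A) → T.typeOf a ∈ D m

/-- `S_Dⁿ(A)`: the complete types `p(x)` over `A` such that `A ∪ c` is a `D`-set whenever `c`
realizes `p` (in any elementary extension of `C`). A finite sequence from `A ∪ c` is given by a map
`g : Fin m → C ⊕ Fin n` with parameters in `A`, and its type over `∅` is read off from `p`. -/
def SD (D : Diag T) (n : ℕ) (A : Set C) : Set (Set (PFormula L C n)) :=
  {p | IsCompleteType A p ∧
    ∀ (m : ℕ) (g : Fin m → C ⊕ Fin n), (∀ i c, g i = Sum.inl c → c ∈ A) →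
      ∃ q ∈ D m, ∀ ψ : L.Formula (Fin m),
        (Formula.equivSentence ψ ∈ q ↔ (ψ.relabel g : PFormula L C n) ∈ p)}

/-- A model `M` (an elementary submodel of `C`) is `(D, κ)`-homogeneous: it is a `D`-model, and it
realizes every type in `S_D(A)` for every `A ⊆ M` of cardinality less than `κ`. -/
def IsHomogeneous [C ⊨ T] [Nonempty C] (D : Diag T) (κ : Cardinal.{w})
    (M : L.ElementarySubstructure C) : Prop :=
  IsDSet D (M : Set C) ∧
  ∀ A : Set C, A ⊆ (M : Set C) → #A < κ → ∀ p : Set (PFormula L C 1), p ∈ SD D 1 A →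
    ∃ c : Fin 1 → C, (∀ i, c i ∈ M) ∧ Realizes c p

/-- The relation `R_A[p] ≥ α`, for sets of formulas `p` with finitely many parameters, all of
them in `A`; by recursion on `α`. -/
noncomputable def RankGE (D : Diag T) (A : Set C) {n : ℕ} (α : Ordinal.{max u v w}) :
    Set (PFormula L C n) → Prop :=
  Ordinal.limitRecOn (motive := fun _ => Set (PFormula L C n) → Prop) α
    (fun p => ∃ c : Fin n → C, Realizes c p)
    (fun _ ih p =>
      (∃ φ : PFormula L C n, params φ ⊆ A ∧ ih (p ∪ {φ}) ∧ ih (p ∪ {φ.not})) ∧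
      (∀ (m : ℕ) (a : Fin m → C), (∀ i, a i ∈ A) →
        ∃ q ∈ D (n + m), ih (p ∪ instType q a)))
    (fun δ _ ih p => ∀ (β : Ordinal.{max u v w}) (h : β < δ), ih β h p)

/-- The values of the rank: `⊥` is `-1`, `⊤` is `∞`. -/
abbrev RankVal : Type (w + 1) := WithBot (WithTop Ordinal.{w})

open Classical in
/-- `R_A[p]` for a set of formulas `p` with finitely many parameters. -/
noncomputable def rankFin (D : Diag T) (A : Set C) {n : ℕ} (p : Set (PFormula L C n)) :
    RankVal.{max u v w} :=
  if ∀ c : Fin n → C, ¬ Realizes c p then ⊥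
  else if ∀ α, RankGE D A α p then ((⊤ : WithTop Ordinal.{max u v w}) : RankVal.{max u v w})
  else ((sInf {α | RankGE D A α p ∧ ¬ RankGE D A (Order.succ α) p} : Ordinal.{max u v w}) :
    WithTop Ordinal.{max u v w})

/-- `R_A[p]` for an arbitrary set of formulas `p` over `A`: the minimum of the ranks of the sets
`q ⊆ p ↾ B`, for finite `B ⊆ dom(p)`. -/
noncomputable def rank (D : Diag T) (A : Set C) {n : ℕ} (p : Set (PFormula L C n)) :
    RankVal.{max u v w} :=
  sInf {r | ∃ B : Set C, B.Finite ∧ B ⊆ dom p ∧ ∃ q, q ⊆ restrict p B ∧ r = rankFin D A q}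

/-- `D` is totally transcendental: `R_A[p] < ∞` for all `A ⊆ C` and all types `p` over `A`. -/
def TotallyTranscendental (D : Diag T) (C : Type w) [L.Structure C] : Prop :=
  ∀ (A : Set C) (n : ℕ) (p : Set (PFormula L C n)), dom p ⊆ A → rank D A p < ⊤

/-- `R[p]`, the rank relative to the whole of `C`. -/
noncomputable def R (D : Diag T) {n : ℕ} (p : Set (PFormula L C n)) : RankVal.{max u v w} :=
  rank D Set.univ p

/-- `p` is stationary: for every `B` containing `dom(p)` there is a unique `p_B ∈ S_D(B)` that
extends `p` and has the same rank as `p`. -/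
def IsStationary (D : Diag T) {n : ℕ} (p : Set (PFormula L C n)) : Prop :=
  ∀ B : Set C, dom p ⊆ B → ∃! pB : Set (PFormula L C n), pB ∈ SD D n B ∧ p ⊆ pB ∧ R D p = R D pB

/-- The tuple `a` is independent from `E` over `B`: `R[tp(a, B)] = R[tp(a, B ∪ E)]`. -/
def Nonfork (D : Diag T) {n : ℕ} (a : Fin n → C) (B E : Set C) : Prop :=
  R D (tp L a B) = R D (tp L a (B ∪ E))

/-- `q` is big for `M`: it is realized outside `M`. -/
def BigFor {n : ℕ} (M : Set C) (q : Set (PFormula L C n)) : Prop :=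
  ∃ c : Fin n → C, Realizes c q ∧ ∃ i, c i ∉ M

/-- A type `p` over `A` is big: for every finite `B ⊆ A`, the type `p ↾ B` is realized outside
every model `M` containing `B`. As usual with a `(D, χ)`-homogeneous monster model `C`, the
models `M` here are the elementary submodels of `C` of cardinality less than `χ`. -/
def IsBig (χ : Cardinal.{w}) {n : ℕ} (A : Set C) (p : Set (PFormula L C n)) : Prop :=
  ∀ B : Set C, B ⊆ A → B.Finite → ∀ M : L.ElementarySubstructure C, #M < χ →
    B ⊆ (M : Set C) → BigFor (M : Set C) (restrict p B)

/-- `p ∈ S_D(A)`, big and stationary, is regular for `M`. -/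
def IsRegularFor (D : Diag T) (χ : Cardinal.{w}) (M : Set C) {n : ℕ} (A : Set C)
    (p : Set (PFormula L C n)) : Prop :=
  p ∈ SD D n A ∧ IsBig χ A p ∧ IsStationary D p ∧ A ⊆ M ∧
  ∀ B : Set C, B ⊆ M → ∀ a b : Fin n → C, (∀ i, a i ∈ M) → (∀ i, b i ∈ M) →
    Realizes a p → Realizes b p →
    Nonfork D a A B → ¬ Nonfork D b A B → Nonfork D a A (B ∪ Set.range b)

/-- `p ∈ S_D(A)` is regular: it is regular for `C`. -/
def IsRegular (D : Diag T) (χ : Cardinal.{w}) {n : ℕ} (A : Set C) (p : Set (PFormula L C n)) :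
    Prop :=
  IsRegularFor D χ Set.univ A p

/-- `p` is realized in `N - M`, for a type `p` in one variable. -/
def RealizedInDiff (M N : Set C) (p : Set (PFormula L C 1)) : Prop :=
  ∃ c : C, c ∈ N ∧ c ∉ M ∧ Realizes (fun _ => c) p

end Rank

end Diagram

/-! Let `c` lie in `N - M` and let `α` be the rank of its type over `M`; a finite `A₀ ⊆ M` already
gives this rank (`IsBasedOn`). Over `M` there is no freedom left: a formula over `M` can be added to
`tp(c, A₀)` without losing rank `α` exactly when `c` satisfies it, since otherwise the formula and
its negation would both keep rank `α` and force rank `α + 1` (`rankGE_union_singleton_iff`). Any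
finite set of parameters in `C` can be moved into `M` over `A₀` by an elementary map, and such maps
preserve rank (`RankGE.of_sameType`). Hence the same dichotomy holds over all of `C`: `tp(c, A₀)` is
stationary (`IsBasedOn.isStationary`), and it is big because the moved parameters lie in `M` while
`c` does not (`IsBasedOn.isBig`).

Regularity is an exchange argument (`nonfork_union_of_minimal`). Let `p = tp(c, A)` have minimal
rank `α`; minimality also shows that `tp(c, M)` has rank `α`. Suppose `a` and `b` realize `p`, `a`
is free from `B`, `b` is not, and `a` is not free from `B ∪ b`. Two finite sets of formulas witness
the failures of freeness. Move their parameters other than `b` into `M` so that `a` corresponds to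
`c`, and use homogeneity of `N` to find `b' ∈ N` corresponding to `b`. If `b' ∈ M`, then `c` has
rank below `α` over `M`; if `b' ∉ M`, then `b'` is an element of `N - M` of rank below `α` over `M`.
Both are impossible. For existence, take `c` in `N - M` whose type over `M` has least rank. -/

namespace Diagram

/-! ### Parameters of formulas under substitution. -/

section Syntactic

open BoundedFormula

variable {L : FirstOrder.Language.{u, v}} {α β γ : Type*}

theorem varFinsetLeft_relabel_subset [DecidableEq α] [DecidableEq β] {k l : ℕ} (g : α → β)
    (h : α ⊕ Fin k → β ⊕ Fin l) (h₁ : ∀ a, h (Sum.inl a) = Sum.inl (g a))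
    (h₂ : ∀ i, ∃ j, h (Sum.inr i) = Sum.inr j) (t : L.Term (α ⊕ Fin k)) :
    (t.relabel h).varFinsetLeft ⊆ t.varFinsetLeft.image g := by
  induction t with
  | var a =>
    rcases a with a | i
    · simp [h₁]
    · obtain ⟨j, hj⟩ := h₂ i
      simp [hj]
  | func f ts ih =>
    intro b hb
    simp only [Term.relabel, Term.varFinsetLeft, Finset.mem_biUnion, Finset.mem_univ,
      true_and] at hb
    obtain ⟨i, hi⟩ := hb
    obtain ⟨a, ha, hab⟩ := Finset.mem_image.1 (ih i hi)
    exact Finset.mem_image.2 ⟨a, Finset.mem_biUnion.2 ⟨i, Finset.mem_univ i, ha⟩, hab⟩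

theorem freeVarFinset_castLE [DecidableEq α] {k l : ℕ} (h : k ≤ l) (φ : L.BoundedFormula α k) :
    (φ.castLE h).freeVarFinset ⊆ φ.freeVarFinset := by
  have key {k l : ℕ} (h : k ≤ l) (t : L.Term (α ⊕ Fin k)) :
      (t.relabel (Sum.map id (Fin.castLE h))).varFinsetLeft ⊆ t.varFinsetLeft := by
    simpa using varFinsetLeft_relabel_subset id (Sum.map id (Fin.castLE h)) (fun _ => rfl)
      (fun i => ⟨_, rfl⟩) t
  induction φ generalizing l with
  | falsum => exact subset_rfl
  | equal t₁ t₂ => exact Finset.union_subset_union (key h t₁) (key h t₂)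
  | rel r ts => exact Finset.biUnion_mono fun i _ => key h (ts i)
  | imp φ ψ ih₁ ih₂ => exact Finset.union_subset_union (ih₁ h) (ih₂ h)
  | all φ ih => exact ih _

theorem freeVarFinset_relabel_inl_subset [DecidableEq α] [DecidableEq β] (g : α → β) {k : ℕ}
    (φ : L.BoundedFormula α k) :
    (φ.relabel (Sum.inl ∘ g : α → β ⊕ Fin 0)).freeVarFinset ⊆ φ.freeVarFinset.image g := by
  have key {k : ℕ} (t : L.Term (α ⊕ Fin k)) :
      (t.relabel (relabelAux (Sum.inl ∘ g : α → β ⊕ Fin 0) k)).varFinsetLeft ⊆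
        t.varFinsetLeft.image g :=
    varFinsetLeft_relabel_subset g _ (fun _ => rfl) (fun i => ⟨_, rfl⟩) t
  induction φ with
  | falsum => exact Finset.empty_subset _
  | equal t₁ t₂ =>
    change _ ∪ _ ⊆ Finset.image g (_ ∪ _)
    rw [Finset.image_union]
    exact Finset.union_subset_union (key t₁) (key t₂)
  | rel r ts =>
    change Finset.biUnion _ _ ⊆ Finset.image g (Finset.biUnion _ _)
    rw [Finset.biUnion_image]
    exact Finset.biUnion_mono fun i _ => key (ts i)
  | imp φ ψ ih₁ ih₂ =>
    change _ ∪ _ ⊆ Finset.image g (_ ∪ _)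
    rw [Finset.image_union]
    exact Finset.union_subset_union ih₁ ih₂
  | all φ ih => exact (freeVarFinset_castLE _ _).trans ih

open Classical in
theorem exists_mem_of_mem_params_relabel {C : Type w} {n : ℕ} {ψ : L.Formula α}
    {g : α → C ⊕ Fin n} {c : C} (h : c ∈ params (ψ.relabel g : PFormula L C n)) :
    ∃ i ∈ freeVarFinset ψ, g i = Sum.inl c := by
  have := freeVarFinset_relabel_inl_subset g ψ h
  simpa using this

variable {C : Type w} {n : ℕ}

theorem finite_params (φ : PFormula L C n) : (params φ).Finite := by
  classical
  exact (BoundedFormula.freeVarFinset φ).finite_toSet.preimage Sum.inl_injective.injOn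

theorem params_not (φ : PFormula L C n) : params φ.not = params φ := by
  classical
  ext c
  simp [params, freeVarFinset]

theorem params_relabel_subset {ψ : L.Formula α} {g : α → C ⊕ Fin n} {A : Set C}
    (h : ∀ i c, g i = Sum.inl c → c ∈ A) : params (ψ.relabel g : PFormula L C n) ⊆ A := by
  intro c hc
  obtain ⟨i, -, hi⟩ := exists_mem_of_mem_params_relabel hc
  exact h i c hi

/-- The set of formulas obtained by substituting the parameters along `f`. -/
def subst (f : C → C) (p : Set (PFormula L C n)) : Set (PFormula L C n) :=
  (fun φ : PFormula L C n => (φ.relabel (Sum.map f id) : PFormula L C n)) '' p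

theorem params_relabel_map_subset (f : C → C) (φ : PFormula L C n) :
    params (φ.relabel (Sum.map f id) : PFormula L C n) ⊆ f '' params φ := by
  classical
  intro c hc
  obtain ⟨i, hi, hic⟩ := exists_mem_of_mem_params_relabel hc
  rcases i with a | j
  · exact ⟨a, by rw [params, Set.mem_ofPred_eq]; convert hi, by simpa using hic⟩
  · simp at hic

theorem params_subset_dom {p : Set (PFormula L C n)} {φ : PFormula L C n} (h : φ ∈ p) :
    params φ ⊆ dom p :=
  fun _ hc => ⟨φ, h, hc⟩

theorem dom_subset_iff {p : Set (PFormula L C n)} {A : Set C} :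
    dom p ⊆ A ↔ ∀ φ ∈ p, params φ ⊆ A :=
  ⟨fun h _ hφ => (params_subset_dom hφ).trans h, fun h _ ⟨φ, hφ, hc⟩ => h φ hφ hc⟩

theorem dom_mono {p q : Set (PFormula L C n)} (h : p ⊆ q) : dom p ⊆ dom q :=
  dom_subset_iff.2 fun _ hφ => params_subset_dom (h hφ)

theorem dom_union_singleton (p : Set (PFormula L C n)) (φ : PFormula L C n) :
    dom (p ∪ {φ}) = dom p ∪ params φ := by
  ext c
  simp only [dom, Set.mem_ofPred_eq, Set.mem_union, Set.mem_singleton_iff]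
  constructor
  · rintro ⟨ψ, h | rfl, hc⟩
    exacts [Or.inl ⟨ψ, h, hc⟩, Or.inr hc]
  · rintro (⟨ψ, h, hc⟩ | hc)
    exacts [⟨ψ, Or.inl h, hc⟩, ⟨φ, Or.inr rfl, hc⟩]

theorem dom_subst_subset (f : C → C) (p : Set (PFormula L C n)) : dom (subst f p) ⊆ f '' dom p := by
  rw [dom_subset_iff]
  rintro _ ⟨φ, hφ, rfl⟩
  exact (params_relabel_map_subset f φ).trans (Set.image_mono (params_subset_dom hφ))

theorem dom_instType_subset {T : L.Theory} {m : ℕ} (q : T.CompleteType (Fin (n + m)))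
    (a : Fin m → C) :
    dom (instType q a : Set (PFormula L C n)) ⊆ Set.range a := by
  rw [dom_subset_iff]
  rintro _ ⟨ψ, -, rfl⟩
  refine params_relabel_subset fun i c => ?_
  refine Fin.addCases (fun i h => ?_) (fun i h => ?_) i
  · simp at h
  · exact ⟨i, by simpa using h⟩

/-- Each parameter is replaced by a variable that `e` sends to it. A single `Φ` serves all `f`, so
truth before and after moving the parameters is compared through one parameter-free formula. -/
theorem exists_formula_realize_iff [L.Structure C] (e : α → C) (φ : PFormula L C n)
    (h : params φ ⊆ Set.range e) :
    ∃ Φ : L.Formula (α ⊕ Fin n), ∀ (f : C → C) (x : Fin n → C),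
      Φ.Realize (Sum.elim (f ∘ e) x) ↔ φ.Realize (Sum.elim f x) := by
  classical
  have key : ∀ a : BoundedFormula.freeVarFinset φ, ∃ b : α ⊕ Fin n, Sum.map e id b = a.1 := by
    rintro ⟨c | i, ha⟩
    · obtain ⟨b, hb⟩ := h (show c ∈ params φ by simpa [params] using ha)
      exact ⟨Sum.inl b, by simp [hb]⟩
    · exact ⟨Sum.inr i, rfl⟩
  choose g hg using key
  refine ⟨BoundedFormula.restrictFreeVar φ g, fun f x =>
    BoundedFormula.realize_restrictFreeVar _ fun a => ?_⟩
  rw [← hg a]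
  rcases g a with b | i <;> rfl

end Syntactic

/-! ### Tuples of the same type over the empty set. -/

section SameType

variable {L : FirstOrder.Language.{u, v}} {C : Type w} [L.Structure C] {ι κ : Type*}

/-- The families `e` and `e'` have the same type over the empty set. -/
def SameType (L : FirstOrder.Language.{u, v}) {C : Type w} [L.Structure C] {ι : Type*}
    (e e' : ι → C) : Prop :=
  ∀ ψ : L.Formula ι, ψ.Realize e ↔ ψ.Realize e'

theorem SameType.refl (e : ι → C) : SameType L e e := fun _ => Iff.rfl

theorem SameType.symm {e e' : ι → C} (h : SameType L e e') : SameType L e' e :=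
  fun ψ => (h ψ).symm

theorem sameType_of_forall_imp {e e' : ι → C} (h : ∀ ψ : L.Formula ι, ψ.Realize e → ψ.Realize e') :
    SameType L e e' := fun ψ => ⟨h ψ, fun h' => by
  by_contra hn
  exact Formula.realize_not.1 (h ψ.not (Formula.realize_not.2 hn)) h'⟩

theorem SameType.comp {e e' : ι → C} (h : SameType L e e') (g : κ → ι) :
    SameType L (e ∘ g) (e' ∘ g) := fun ψ => by
  rw [← Formula.realize_relabel, ← Formula.realize_relabel]
  exact h _

/-- Equalities between coordinates are part of the type, so the correspondence is well defined on
the range of `e`. Outside this range `f` is the identity, a default value carrying no information.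
-/
theorem SameType.exists_comp_eq {e e' : ι → C} (h : SameType L e e') : ∃ f : C → C, f ∘ e = e' := by
  have hf : e'.FactorsThrough e := fun i j hij => by
    have := h (Term.equal (Term.var i) (Term.var j))
    simpa [Formula.realize_equal, hij] using this
  exact ⟨Function.extend e e' id, funext fun i => hf.extend_apply _ _⟩

variable {n : ℕ}

theorem SameType.realize_iff {e e' : ι → C} {x x' : Fin n → C}
    (h : SameType L (Sum.elim e x) (Sum.elim e' x')) {f : C → C} (hf : f ∘ e = e')
    {φ : PFormula L C n} (hφ : params φ ⊆ Set.range e) :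
    φ.Realize (Sum.elim id x) ↔ (φ.relabel (Sum.map f id) : PFormula L C n).Realize
      (Sum.elim id x') := by
  obtain ⟨Φ, hΦ⟩ := exists_formula_realize_iff e φ hφ
  rw [Formula.realize_relabel, Sum.elim_comp_map, Function.id_comp, Function.comp_id, ← hΦ id x,
    ← hΦ f x', hf]
  exact h Φ

theorem SameType.realizes_iff {e e' : ι → C} {x x' : Fin n → C}
    (h : SameType L (Sum.elim e x) (Sum.elim e' x')) {f : C → C} (hf : f ∘ e = e')
    {p : Set (PFormula L C n)} (hp : dom p ⊆ Set.range e) :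
    Realizes x p ↔ Realizes x' (subst f p) := by
  simp only [Realizes, subst, Set.forall_mem_image]
  exact forall₂_congr fun φ hφ => h.realize_iff hf (dom_subset_iff.1 hp φ hφ)

theorem realizes_union {x : Fin n → C} {p q : Set (PFormula L C n)} :
    Realizes x (p ∪ q) ↔ Realizes x p ∧ Realizes x q := by
  simp only [Realizes, Set.mem_union, or_imp, forall_and]

theorem realizes_singleton {x : Fin n → C} {φ : PFormula L C n} :
    Realizes x {φ} ↔ φ.Realize (Sum.elim id x) := by
  simp [Realizes]

theorem Realizes.mono {x : Fin n → C} {p q : Set (PFormula L C n)} (h : Realizes x q)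
    (hpq : p ⊆ q) : Realizes x p := fun φ hφ => h φ (hpq hφ)

theorem realizes_tp (x : Fin n → C) (A : Set C) : Realizes x (tp L x A) := fun _ h => h.2

theorem dom_tp_subset (x : Fin n → C) (A : Set C) : dom (tp L x A) ⊆ A :=
  dom_subset_iff.2 fun _ h => h.1

theorem tp_mono (x : Fin n → C) {A B : Set C} (h : A ⊆ B) : tp L x A ⊆ tp L x B :=
  fun _ hφ => ⟨hφ.1.trans h, hφ.2⟩

theorem subset_tp_iff {x : Fin n → C} {A : Set C} {p : Set (PFormula L C n)} :
    p ⊆ tp L x A ↔ dom p ⊆ A ∧ Realizes x p :=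
  ⟨fun h => ⟨(dom_mono h).trans (dom_tp_subset x A), (realizes_tp x A).mono h⟩,
    fun h φ hφ => ⟨(params_subset_dom hφ).trans h.1, h.2 φ hφ⟩⟩

theorem IsCompleteType.eq_of_subset {A : Set C} {p q : Set (PFormula L C n)}
    (hp : IsCompleteType A p) (hq : IsCompleteType A q) (h : p ⊆ q) : p = q := by
  refine h.antisymm fun φ hφ => ?_
  by_contra hn
  have h₁ := h ((hp.2.1 φ (hq.1 φ hφ)).resolve_left hn)
  obtain ⟨c, hc⟩ := hq.2.2 {φ, φ.not} (by simp [Set.insert_subset_iff, hφ, h₁]) (by simp)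
  exact Formula.realize_not.1 (hc φ.not (by simp)) (hc φ (by simp))

theorem isCompleteType_tp (x : Fin n → C) (A : Set C) : IsCompleteType A (tp L x A) := by
  refine ⟨fun φ h => h.1, fun φ hφ => ?_, fun s hs _ => ⟨x, (realizes_tp x A).mono hs⟩⟩
  by_cases h : φ.Realize (Sum.elim id x)
  · exact Or.inl ⟨hφ, h⟩
  · exact Or.inr ⟨(params_not φ).trans_subset hφ, Formula.realize_not.2 h⟩

theorem IsCompleteType.eq_tp {A : Set C} {p : Set (PFormula L C n)} (hp : IsCompleteType A p)
    {x : Fin n → C} (hx : Realizes x p) : p = tp L x A :=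
  hp.eq_of_subset (isCompleteType_tp x A) fun φ hφ => ⟨hp.1 φ hφ, hx φ hφ⟩

variable {T : L.Theory}

theorem realizes_instType_iff {m : ℕ} {q : T.CompleteType (Fin (n + m))} {a : Fin m → C}
    {x : Fin n → C} : Realizes x (instType q a) ↔
      ∀ ψ : L.Formula (Fin (n + m)), Formula.equivSentence ψ ∈ q → ψ.Realize (Fin.append x a) := by
  have key : Sum.elim id x ∘
      Fin.append (fun i : Fin n => (Sum.inr i : C ⊕ Fin n)) (fun j => Sum.inl (a j)) =
        Fin.append x a := by
    ext i
    refine Fin.addCases (fun i => ?_) (fun i => ?_) i <;> simp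
  constructor
  · intro h ψ hψ
    have := h _ ⟨ψ, hψ, rfl⟩
    rwa [Formula.realize_relabel, key] at this
  · rintro h _ ⟨ψ, hψ, rfl⟩
    rw [Formula.realize_relabel, key]
    exact h ψ hψ

theorem append_eq_sumElim_comp {m : ℕ} {α : Type*} (x : Fin n → α) (a : Fin m → α) :
    Fin.append x a = Sum.elim x a ∘ finSumFinEquiv.symm := by
  ext i
  refine Fin.addCases (fun i => ?_) (fun i => ?_) i <;> simp

theorem SameType.realizes_instType_iff {m : ℕ} {q : T.CompleteType (Fin (n + m))}
    {a a' : Fin m → C} {x x' : Fin n → C} (h : SameType L (Sum.elim a x) (Sum.elim a' x')) :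
    Realizes x (instType q a) ↔ Realizes x' (instType q a') := by
  rw [Diagram.realizes_instType_iff, Diagram.realizes_instType_iff]
  refine forall₂_congr fun ψ _ => ?_
  have := h.comp (Sum.swap ∘ finSumFinEquiv.symm)
  rw [← Function.comp_assoc, ← Function.comp_assoc, Sum.elim_swap, Sum.elim_swap,
    ← append_eq_sumElim_comp, ← append_eq_sumElim_comp] at this
  exact this ψ

theorem realizes_instType_typeOf [C ⊨ T] [Nonempty C] {m : ℕ} (x : Fin n → C) (a : Fin m → C) :
    Realizes x (instType (T.typeOf (Fin.append x a)) a) :=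
  Diagram.realizes_instType_iff.2 fun _ h => Theory.CompleteType.formula_mem_typeOf.1 h

end SameType

/-! ### Extending elementary correspondences inside homogeneous models. -/

section Homogeneous

variable {L : FirstOrder.Language.{u, v}} {T : L.Theory} {C : Type w} [L.Structure C] [C ⊨ T]
  [Nonempty C] {D : Diag T} {κ : Cardinal.{w}} {ι : Type*} [Finite ι]

/-- The type of `d` over `e`, transported to the parameters `e'`, belongs to `S_D`, since its
restrictions are types of tuples of the `D`-set `C`. It has finitely many parameters, so `K`
realizes it. -/
theorem SameType.exists_extend_one (hC : IsDSet D (Set.univ : Set C))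
    {K : L.ElementarySubstructure C} (hK : IsHomogeneous D κ K) (hκ : ℵ₀ ≤ κ) {e e' : ι → C}
    (h : SameType L e e') (he' : ∀ i, e' i ∈ K) (d : Fin 1 → C) :
    ∃ d' : Fin 1 → C, (∀ i, d' i ∈ K) ∧ SameType L (Sum.elim e d) (Sum.elim e' d') := by
  obtain ⟨f, hf⟩ := h.symm.exists_comp_eq
  let p : Set (PFormula L C 1) :=
    {φ | params φ ⊆ Set.range e' ∧ φ.Realize (Sum.elim f d)}
  have hp : p ∈ SD D 1 (Set.range e') := by
    refine ⟨⟨fun φ hφ => hφ.1, fun φ hφ => ?_, fun s hs hfin => ?_⟩, fun m g hg => ?_⟩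
    · by_cases hr : φ.Realize (Sum.elim f d)
      · exact Or.inl ⟨hφ, hr⟩
      · exact Or.inr ⟨(params_not φ).trans_subset hφ, Formula.realize_not.2 hr⟩
    · have := hfin.to_subtype
      choose Φ hΦ using fun φ : s => exists_formula_realize_iff e' φ.1 (hs φ.2).1
      -- Satisfiability of finitely many transported formulas is a single existential statement,
      -- which passes from `e` to `e'`.
      let Ψ : L.Formula ι := Formula.iExs (Fin 1) (Formula.iInf Φ)
      have h₁ : Ψ.Realize e := by
        refine Formula.realize_iExs.2 ⟨d, Formula.realize_iInf.2 fun φ => ?_⟩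
        rw [← hf]
        exact (hΦ φ f d).2 (hs φ.2).2
      obtain ⟨c, hc⟩ := Formula.realize_iExs.1 ((h Ψ).1 h₁)
      exact ⟨c, fun φ hφ => (hΦ ⟨φ, hφ⟩ id c).1 (Formula.realize_iInf.1 hc ⟨φ, hφ⟩)⟩
    · refine ⟨_, hC m (Sum.elim f d ∘ g) (fun _ => trivial), fun ψ => ?_⟩
      rw [Theory.CompleteType.formula_mem_typeOf, ← Formula.realize_relabel]
      exact ⟨fun hψ => ⟨params_relabel_subset hg, hψ⟩, fun hψ => hψ.2⟩
  obtain ⟨d', hd', hr⟩ := hK.2 _ (Set.range_subset_iff.2 he')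
    ((Cardinal.lt_aleph0_iff_set_finite.2 (Set.finite_range e')).trans_le hκ) p hp
  refine ⟨d', hd', sameType_of_forall_imp fun Φ hΦ => ?_⟩
  have := hr (Φ.relabel (Sum.map e' id)) ⟨params_relabel_subset fun i c hic => ?_, ?_⟩
  · simpa [Formula.realize_relabel, Sum.elim_comp_map] using this
  · rcases i with i | i
    · exact ⟨i, by simpa using hic⟩
    · simp at hic
  · simpa [Formula.realize_relabel, Sum.elim_comp_map, hf] using hΦ

theorem SameType.exists_extend (hC : IsDSet D (Set.univ : Set C))
    {K : L.ElementarySubstructure C} (hK : IsHomogeneous D κ K) (hκ : ℵ₀ ≤ κ) {e e' : ι → C}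
    (h : SameType L e e') (he' : ∀ i, e' i ∈ K) {m : ℕ} (d : Fin m → C) :
    ∃ d' : Fin m → C, (∀ i, d' i ∈ K) ∧ SameType L (Sum.elim e d) (Sum.elim e' d') := by
  induction m with
  | zero =>
    refine ⟨d, fun i => i.elim0, ?_⟩
    have hs (e : ι → C) : Sum.elim e d = e ∘ Sum.elim id Fin.elim0 := by
      ext (i | i)
      · rfl
      · exact i.elim0
    rw [hs e, hs e']
    exact h.comp _
  | succ m ih =>
    obtain ⟨d₁, hd₁, h₁⟩ := ih (Fin.init d)
    obtain ⟨d₂, hd₂, h₂⟩ := h₁.exists_extend_one hC hK hκ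
      (by rintro (i | i); exacts [he' i, hd₁ i]) (fun _ => d (Fin.last m))
    refine ⟨Fin.snoc (α := fun _ => C) d₁ (d₂ 0), fun i => ?_, ?_⟩
    · refine Fin.lastCases ?_ (fun i => ?_) i
      · simpa using hd₂ 0
      · simpa using hd₁ i
    · have hs (e : ι → C) (x : Fin m → C) (y : Fin 1 → C) :
          Sum.elim e (Fin.snoc (α := fun _ => C) x (y 0)) = Sum.elim (Sum.elim e x) y ∘
            Sum.elim (Sum.inl ∘ Sum.inl)
              (Fin.snoc (α := fun _ => (ι ⊕ Fin m) ⊕ Fin 1) (Sum.inl ∘ Sum.inr) (Sum.inr 0)) := by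
        ext (i | i)
        · rfl
        · refine Fin.lastCases ?_ (fun i => ?_) i <;> simp
      have := h₂.comp (Sum.elim (Sum.inl ∘ Sum.inl)
        (Fin.snoc (α := fun _ => (ι ⊕ Fin m) ⊕ Fin 1) (Sum.inl ∘ Sum.inr) (Sum.inr 0)))
      rw [← hs, ← hs] at this
      simpa using this

theorem tp_mem_SD (hC : IsDSet D (Set.univ : Set C)) {n : ℕ} (x : Fin n → C) (A : Set C) :
    tp L x A ∈ SD D n A := by
  refine ⟨isCompleteType_tp x A, fun m g hg => ⟨_, hC m (Sum.elim id x ∘ g) fun _ => trivial,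
    fun ψ => ?_⟩⟩
  rw [Theory.CompleteType.formula_mem_typeOf, ← Formula.realize_relabel]
  exact ⟨fun hψ => ⟨params_relabel_subset hg, hψ⟩, fun hψ => hψ.2⟩

end Homogeneous

/-! ### The rank and its invariance. -/

section Rank

variable {L : FirstOrder.Language.{u, v}} {T : L.Theory} {C : Type w} [L.Structure C]
  {D : Diag T} {A : Set C} {n : ℕ}

theorem rankGE_zero {p : Set (PFormula L C n)} :
    RankGE D A 0 p ↔ ∃ c : Fin n → C, Realizes c p := by
  rw [RankGE, Ordinal.limitRecOn_zero]

theorem rankGE_add_one {α : Ordinal.{max u v w}} {p : Set (PFormula L C n)} :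
    RankGE D A (α + 1) p ↔
      (∃ φ : PFormula L C n, params φ ⊆ A ∧ RankGE D A α (p ∪ {φ}) ∧
        RankGE D A α (p ∪ {φ.not})) ∧
      (∀ (m : ℕ) (a : Fin m → C), (∀ i, a i ∈ A) →
        ∃ q ∈ D (n + m), RankGE D A α (p ∪ instType q a)) := by
  rw [RankGE, Ordinal.limitRecOn_add_one]
  rfl

theorem rankGE_limit {δ : Ordinal.{max u v w}} (hδ : Order.IsSuccLimit δ)
    {p : Set (PFormula L C n)} : RankGE D A δ p ↔ ∀ β < δ, RankGE D A β p := by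
  rw [RankGE, Ordinal.limitRecOn_limit _ _ _ _ hδ]
  rfl

/-- The recursion only adds formulas and finally asks for a realization, so the rank depends on the
solution set alone and is monotone in it. -/
theorem RankGE.of_realizes_imp {α : Ordinal.{max u v w}} {p p' : Set (PFormula L C n)}
    (h : RankGE D A α p) (hp : ∀ c, Realizes c p → Realizes c p') : RankGE D A α p' := by
  induction α using Ordinal.limitRecOn generalizing p p' with
  | zero =>
    obtain ⟨c, hc⟩ := rankGE_zero.1 h
    exact rankGE_zero.2 ⟨c, hp c hc⟩
  | add_one α ih =>
    obtain ⟨⟨φ, hφ, h₁, h₂⟩, h₃⟩ := rankGE_add_one.1 h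
    have key (s : Set (PFormula L C n)) (c : Fin n → C) (hc : Realizes c (p ∪ s)) :
        Realizes c (p' ∪ s) :=
      realizes_union.2 ((realizes_union.1 hc).imp_left (hp c))
    refine rankGE_add_one.2 ⟨⟨φ, hφ, ih h₁ (key _), ih h₂ (key _)⟩, fun m a ha => ?_⟩
    obtain ⟨q, hq, hr⟩ := h₃ m a ha
    exact ⟨q, hq, ih hr (key _)⟩
  | limit δ hδ ih =>
    rw [rankGE_limit hδ] at h ⊢
    exact fun β hβ => ih β hβ (h β hβ) hp

theorem RankGE.mono {α : Ordinal.{max u v w}} {p p' : Set (PFormula L C n)}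
    (h : RankGE D A α p) (hp : p' ⊆ p) : RankGE D A α p' :=
  h.of_realizes_imp fun _ hc => hc.mono hp

theorem RankGE.of_le {α β : Ordinal.{max u v w}} {p : Set (PFormula L C n)}
    (h : RankGE D A β p) (hαβ : α ≤ β) : RankGE D A α p := by
  induction β using Ordinal.limitRecOn generalizing p with
  | zero => rwa [nonpos_iff_eq_zero.1 hαβ]
  | add_one β ih =>
    rcases hαβ.eq_or_lt with rfl | hlt
    · exact h
    · obtain ⟨⟨φ, -, h₁, -⟩, -⟩ := rankGE_add_one.1 h
      exact ih (h₁.mono Set.subset_union_left) (Order.lt_add_one_iff.1 hlt)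
  | limit δ hδ ih =>
    rcases hαβ.eq_or_lt with rfl | hlt
    · exact h
    · exact (rankGE_limit hδ).1 h α hlt

/-- The infimum defining `rankFin` is attained: the condition holds at `0` and passes to limits, so
if it ever fails it first fails at a successor. -/
theorem le_rankFin_iff {α : Ordinal.{max u v w}} {p : Set (PFormula L C n)} :
    ((α : WithTop Ordinal.{max u v w}) : RankVal.{max u v w}) ≤ rankFin D A p ↔
      RankGE D A α p := by
  unfold rankFin
  split_ifs with h₁ h₂
  · simp only [le_bot_iff, WithBot.coe_ne_bot, false_iff]
    intro h
    obtain ⟨c, hc⟩ := rankGE_zero.1 (h.of_le zero_le)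
    exact h₁ c hc
  · simpa using h₂ α
  · push Not at h₁ h₂
    have hne : {α : Ordinal.{max u v w} | RankGE D A α p ∧
        ¬ RankGE D A (Order.succ α) p}.Nonempty := by
      by_contra hempty
      obtain ⟨β, hβ⟩ := h₂
      refine hβ ?_
      induction β using Ordinal.limitRecOn with
      | zero => exact rankGE_zero.2 h₁
      | add_one β ih =>
        by_contra hn
        by_cases hb : RankGE D A β p
        · exact hempty ⟨β, hb, hn⟩
        · exact hb (ih hb)
      | limit δ hδ ih =>
        refine (rankGE_limit hδ).2 fun β hlt => ?_
        by_contra hb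
        exact hb (ih β hlt hb)
    have hmem := csInf_mem hne
    rw [WithBot.coe_le_coe, WithTop.coe_le_coe]
    refine ⟨fun h => hmem.1.of_le h, fun h => ?_⟩
    by_contra hlt
    exact hmem.2 (h.of_le (Order.succ_le_of_lt (not_le.1 hlt)))

theorem le_R_iff {α : Ordinal.{max u v w}} {p : Set (PFormula L C n)} :
    ((α : WithTop Ordinal.{max u v w}) : RankVal.{max u v w}) ≤ R D p ↔
      ∀ q ⊆ p, (dom q).Finite → RankGE D Set.univ α q := by
  simp only [R, rank, le_sInf_iff]
  constructor
  · intro h q hq hfin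
    refine le_rankFin_iff.1 (h _ ⟨dom q, hfin, dom_mono hq, q, fun φ hφ => ?_, rfl⟩)
    exact ⟨hq hφ, params_subset_dom hφ⟩
  · rintro h _ ⟨B, hB, -, q, hq, rfl⟩
    exact le_rankFin_iff.2 (h q (fun φ hφ => (hq hφ).1)
      (hB.subset (dom_subset_iff.2 fun φ hφ => (hq hφ).2)))

theorem R_mono {p q : Set (PFormula L C n)} (h : p ⊆ q) : R D q ≤ R D p :=
  sInf_le_sInf fun _ ⟨B, hB, hd, s, hs, hr⟩ =>
    ⟨B, hB, hd.trans (dom_mono h), s, fun _ hφ => ⟨h (hs hφ).1, (hs hφ).2⟩, hr⟩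

theorem TotallyTranscendental.exists_R_eq (hD : TotallyTranscendental D C)
    {p : Set (PFormula L C n)} (hp : ∃ c, Realizes c p) :
    ∃ α : Ordinal.{max u v w}, R D p = ((α : WithTop Ordinal.{max u v w}) : RankVal) := by
  have h₀ : (((0 : Ordinal.{max u v w}) : WithTop Ordinal.{max u v w}) : RankVal) ≤ R D p :=
    le_R_iff.2 fun q hq _ => rankGE_zero.2 (hp.imp fun c hc => hc.mono hq)
  have h₁ : R D p < ⊤ := hD Set.univ n p (Set.subset_univ _)
  revert h₀ h₁
  induction R D p using WithBot.recBotCoe with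
  | bot => simp
  | coe r =>
    induction r using WithTop.recTopCoe with
    | top => intro _ h; exact absurd h (lt_irrefl _)
    | coe α => exact fun _ _ => ⟨α, rfl⟩

theorem exists_not_rankGE_of_R_lt {α : Ordinal.{max u v w}} {p : Set (PFormula L C n)}
    (h : R D p < ((α : WithTop Ordinal.{max u v w}) : RankVal)) :
    ∃ q ⊆ p, (dom q).Finite ∧ ¬ RankGE D Set.univ α q := by
  rw [← not_le, le_R_iff] at h
  push Not at h
  exact h

theorem exists_not_rankGE_add_one_of_R_eq {α : Ordinal.{max u v w}} {p : Set (PFormula L C n)}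
    (h : R D p = ((α : WithTop Ordinal.{max u v w}) : RankVal)) :
    ∃ q ⊆ p, (dom q).Finite ∧ ¬ RankGE D Set.univ (α + 1) q :=
  exists_not_rankGE_of_R_lt <| by
    rw [h, WithBot.coe_lt_coe, WithTop.coe_lt_coe]
    exact lt_add_one α

theorem R_le_of_not_rankGE_add_one {α : Ordinal.{max u v w}} {p q : Set (PFormula L C n)}
    (hq : q ⊆ p) (hfin : (dom q).Finite) (h : ¬ RankGE D Set.univ (α + 1) q) :
    R D p ≤ ((α : WithTop Ordinal.{max u v w}) : RankVal) := by
  by_contra hlt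
  rw [not_le] at hlt
  refine h (le_R_iff.1 ?_ q hq hfin)
  revert hlt
  induction R D p using WithBot.recBotCoe with
  | bot => simp
  | coe r =>
    induction r using WithTop.recTopCoe with
    | top => simp
    | coe β =>
      simp only [WithBot.coe_lt_coe, WithTop.coe_lt_coe, WithBot.coe_le_coe, WithTop.coe_le_coe]
      exact Order.add_one_le_of_lt

/-- A type has the same rank as its restriction to some finite part of the set of its
parameters. -/
theorem exists_finite_R_tp_eq (hD : TotallyTranscendental D C) (c : Fin n → C) (A : Set C) :
    ∃ B : Set C, B.Finite ∧ B ⊆ A ∧ R D (tp L c B) = R D (tp L c A) := by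
  obtain ⟨α, hα⟩ := hD.exists_R_eq ⟨c, realizes_tp c A⟩
  obtain ⟨q, hq, hfin, hr⟩ := exists_not_rankGE_add_one_of_R_eq hα
  have hqA := subset_tp_iff.1 hq
  refine ⟨dom q, hfin, hqA.1, le_antisymm ?_ (R_mono (tp_mono c hqA.1))⟩
  rw [hα]
  exact R_le_of_not_rankGE_add_one (subset_tp_iff.2 ⟨subset_rfl, hqA.2⟩) hfin hr

variable [C ⊨ T] [Nonempty C]

/-- The rank is invariant under elementary maps. -/
theorem RankGE.of_sameType {κ : Cardinal.{w}}
    (hC : IsHomogeneous D κ (⊤ : L.ElementarySubstructure C))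
    (hκ : ℵ₀ ≤ κ) {α : Ordinal.{max u v w}} {ι : Type} [Finite ι] {e e' : ι → C}
    (he : SameType L e e') {p p' : Set (PFormula L C n)}
    (hp : ∀ c c' : Fin n → C, SameType L (Sum.elim e c) (Sum.elim e' c') →
      (Realizes c p ↔ Realizes c' p'))
    (h : RankGE D Set.univ α p) : RankGE D Set.univ α p' := by
  have hC' : IsDSet D (Set.univ : Set C) := hC.1
  have ext {ι : Type} [Finite ι] {e e' : ι → C} (he : SameType L e e') {m : ℕ} (d : Fin m → C) :
      ∃ d', SameType L (Sum.elim e d) (Sum.elim e' d') :=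
    (he.exists_extend hC' hC hκ (fun _ => trivial) d).imp fun _ => And.right
  have proj {ι : Type} {e e' : ι → C} {m : ℕ} {d d' : Fin m → C} {c c' : Fin n → C}
      (h : SameType L (Sum.elim (Sum.elim e d) c) (Sum.elim (Sum.elim e' d') c')) :
      SameType L (Sum.elim e c) (Sum.elim e' c') ∧ SameType L (Sum.elim d c) (Sum.elim d' c') := by
    have h₁ := h.comp (Sum.map Sum.inl id)
    have h₂ := h.comp (Sum.map Sum.inr id)
    simp only [Sum.elim_comp_map, Sum.elim_comp_inl, Sum.elim_comp_inr, Function.comp_id] at h₁ h₂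
    exact ⟨h₁, h₂⟩
  induction α using Ordinal.limitRecOn generalizing ι p p' with
  | zero =>
    obtain ⟨c, hc⟩ := rankGE_zero.1 h
    obtain ⟨c', hc'⟩ := ext he c
    exact rankGE_zero.2 ⟨c', (hp c c' hc').1 hc⟩
  | add_one α ih =>
    obtain ⟨⟨φ, -, h₁, h₂⟩, h₃⟩ := rankGE_add_one.1 h
    refine rankGE_add_one.2 ⟨?_, fun m a' _ => ?_⟩
    -- The parameters of the splitting formula are adjoined to the correspondence, so that the
    -- induction hypothesis applies to the longer tuples.
    · obtain ⟨k, d, -, hd⟩ := (finite_params φ).fin_param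
      obtain ⟨d', hd'⟩ := ext he d
      obtain ⟨f, hf⟩ := (hd'.comp Sum.inr).exists_comp_eq
      simp only [Sum.elim_comp_inr] at hf
      have key (c c' : Fin n → C)
          (h : SameType L (Sum.elim (Sum.elim e d) c) (Sum.elim (Sum.elim e' d') c')) :
          φ.Realize (Sum.elim id c) ↔
            (φ.relabel (Sum.map f id) : PFormula L C n).Realize (Sum.elim id c') :=
        (proj h).2.realize_iff hf hd.ge
      refine ⟨φ.relabel (Sum.map f id), Set.subset_univ _, ih hd' (fun c c' h => ?_) h₁,
        ih hd' (fun c c' h => ?_) h₂⟩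
      · rw [realizes_union, realizes_union, realizes_singleton, realizes_singleton, key c c' h,
          hp c c' (proj h).1]
      · rw [realizes_union, realizes_union, realizes_singleton, realizes_singleton,
          Formula.realize_not, Formula.realize_not, key c c' h, hp c c' (proj h).1]
    -- Here the challenge `a'` is given on the target side, so the correspondence is extended
    -- backwards.
    · obtain ⟨a, ha⟩ := ext he.symm a'
      obtain ⟨q, hq, hr⟩ := h₃ m a fun _ => trivial
      refine ⟨q, hq, ih ha.symm (fun c c' h => ?_) hr⟩
      rw [realizes_union, realizes_union, hp c c' (proj h).1, (proj h).2.realizes_instType_iff]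
  | limit δ hδ ih =>
    rw [rankGE_limit hδ] at h ⊢
    exact fun β hβ => ih β hβ he hp (h β hβ)

end Rank

theorem finite_dom_singleton {L : FirstOrder.Language.{u, v}} {C : Type w} {n : ℕ}
    (φ : PFormula L C n) : (dom {φ}).Finite :=
  (finite_params φ).subset (dom_subset_iff.2 (by rintro _ rfl; exact subset_rfl))

/-! ### Stationarity and bigness by moving finite parameter sets into `M`. -/

section Move

variable {L : FirstOrder.Language.{u, v}} {T : L.Theory} {C : Type w} [L.Structure C]
  {D : Diag T} {n : ℕ}

theorem realize_congr_params {f g : C → C} {x : Fin n → C} {φ : PFormula L C n}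
    (h : Set.EqOn f g (params φ)) : φ.Realize (Sum.elim f x) ↔ φ.Realize (Sum.elim g x) := by
  obtain ⟨Φ, hΦ⟩ := exists_formula_realize_iff (Subtype.val : params φ → C) φ
    (by rw [Subtype.range_coe])
  rw [← hΦ f x, ← hΦ g x, show f ∘ (Subtype.val : params φ → C) = g ∘ Subtype.val from
    funext fun c => h c.2]

theorem realize_relabel_map {f : C → C} {x : Fin n → C} {φ : PFormula L C n} :
    (φ.relabel (Sum.map f id) : PFormula L C n).Realize (Sum.elim id x) ↔
      φ.Realize (Sum.elim f x) := by
  rw [Formula.realize_relabel, Sum.elim_comp_map, Function.id_comp, Function.comp_id]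

theorem realizes_subst_iff {f : C → C} {x : Fin n → C} {p : Set (PFormula L C n)} :
    Realizes x (subst f p) ↔ ∀ φ ∈ p, φ.Realize (Sum.elim f x) := by
  simp only [Realizes, subst, Set.forall_mem_image]
  exact forall₂_congr fun φ _ => realize_relabel_map

theorem realizes_subst_iff_of_eqOn {f : C → C} {x : Fin n → C} {p : Set (PFormula L C n)}
    (h : Set.EqOn f id (dom p)) : Realizes x (subst f p) ↔ Realizes x p :=
  realizes_subst_iff.trans <| forall₂_congr fun _ hφ =>
    realize_congr_params (h.mono (params_subset_dom hφ))

variable {M : L.ElementarySubstructure C} {A₀ : Set C}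

/-- The extension of `tp(c, A₀)` to a type over `B` of the same rank. -/
def freeExtension (D : Diag T) (c : Fin n → C) (A₀ : Set C) (α : Ordinal.{max u v w})
    (B : Set C) : Set (PFormula L C n) :=
  {φ | params φ ⊆ B ∧ RankGE D Set.univ α (tp L c A₀ ∪ {φ})}

/-- The type of `c` over `M` has rank `α`, and this is already the rank of its restriction to
the finite set `A₀ ⊆ M`. -/
structure IsBasedOn (D : Diag T) (M : L.ElementarySubstructure C) (c : Fin n → C) (A₀ : Set C)
    (α : Ordinal.{max u v w}) : Prop where
  finite : A₀.Finite
  subset : A₀ ⊆ M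
  R_tp_base : R D (tp L c A₀) = ((α : WithTop Ordinal.{max u v w}) : RankVal)
  R_tp : R D (tp L c (M : Set C)) = ((α : WithTop Ordinal.{max u v w}) : RankVal)

namespace IsBasedOn

variable {c : Fin n → C} {α : Ordinal.{max u v w}}

theorem rankGE (h : IsBasedOn D M c A₀ α) {S : Set (PFormula L C n)} (hS : S ⊆ tp L c (M : Set C))
    (hfin : (dom S).Finite) : RankGE D Set.univ α S :=
  le_R_iff.1 h.R_tp.ge S hS hfin

theorem rankGE_base (h : IsBasedOn D M c A₀ α) : RankGE D Set.univ α (tp L c A₀) :=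
  le_R_iff.1 h.R_tp_base.ge _ subset_rfl (h.finite.subset (dom_tp_subset c A₀))

theorem not_rankGE_add_one (h : IsBasedOn D M c A₀ α) :
    ¬ RankGE D Set.univ (α + 1) (tp L c A₀) := by
  obtain ⟨q, hq, -, hr⟩ := exists_not_rankGE_add_one_of_R_eq h.R_tp_base
  exact fun hn => hr (hn.mono hq)

theorem rankGE_union (h : IsBasedOn D M c A₀ α) {S : Set (PFormula L C n)}
    (hS : S ⊆ tp L c (M : Set C)) (hfin : (dom S).Finite) :
    RankGE D Set.univ α (tp L c A₀ ∪ S) :=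
  h.rankGE (Set.union_subset (tp_mono c h.subset) hS) <| by
    refine (h.finite.union hfin).subset (dom_subset_iff.2 ?_)
    rintro φ (hφ | hφ)
    · exact hφ.1.trans Set.subset_union_left
    · exact (params_subset_dom hφ).trans Set.subset_union_right

theorem tp_subset_freeExtension (h : IsBasedOn D M c A₀ α) {B : Set C}
    (hB : dom (tp L c A₀) ⊆ B) : tp L c A₀ ⊆ freeExtension D c A₀ α B := fun φ hφ =>
  ⟨(params_subset_dom hφ).trans hB, by
    rw [Set.union_eq_self_of_subset_right (Set.singleton_subset_iff.2 hφ)]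
    exact h.rankGE_base⟩

end IsBasedOn

variable [C ⊨ T] [Nonempty C] {κ : Cardinal.{w}}

/-- Start from the identity on `A₀` and extend it to `E` inside `M`. The map `f` is elementary only
on `A₀ ∪ E`, as recorded by the enumeration `e`. -/
theorem IsHomogeneous.exists_map (hM : IsHomogeneous D κ M) (hκ : ℵ₀ ≤ κ)
    (hC : IsDSet D (Set.univ : Set C)) (hA₀ : A₀.Finite) (hA₀M : A₀ ⊆ M) {E : Set C}
    (hE : E.Finite) :
    ∃ f : C → C, (∀ x ∈ E, f x ∈ M) ∧ Set.EqOn f id A₀ ∧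
      ∃ (k : ℕ) (e : Fin k → C), Set.range e = A₀ ∪ E ∧ SameType L e (f ∘ e) := by
  obtain ⟨l, a, -, rfl⟩ := hA₀.fin_param
  obtain ⟨k, e, -, rfl⟩ := hE.fin_param
  obtain ⟨e', he', h⟩ := (SameType.refl (L := L) a).exists_extend hC hM hκ
    (fun i => hA₀M ⟨i, rfl⟩) e
  obtain ⟨f, hf⟩ := h.exists_comp_eq
  have hfa (i : Fin l) : f (a i) = a i := congrFun hf (Sum.inl i)
  have hfe (i : Fin k) : f (e i) = e' i := congrFun hf (Sum.inr i)
  refine ⟨f, ?_, ?_, l + k, Sum.elim a e ∘ finSumFinEquiv.symm, ?_, ?_⟩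
  · rintro _ ⟨i, rfl⟩
    rw [hfe]
    exact he' i
  · rintro _ ⟨i, rfl⟩
    exact hfa i
  · rw [finSumFinEquiv.symm.surjective.range_comp, Set.Sum.elim_range]
  · rw [← Function.comp_assoc, hf]
    exact h.comp _

theorem rankGE_union_subst_iff (hC : IsHomogeneous D κ (⊤ : L.ElementarySubstructure C))
    (hκ : ℵ₀ ≤ κ) {α : Ordinal.{max u v w}} {k : ℕ} {e : Fin k → C} {f : C → C}
    (h : SameType L e (f ∘ e)) {p S : Set (PFormula L C n)} (hp : dom p ⊆ Set.range e)
    (hS : dom S ⊆ Set.range e) (hfp : Set.EqOn f id (dom p)) :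
    RankGE D Set.univ α (p ∪ S) ↔ RankGE D Set.univ α (p ∪ subst f S) := by
  have key (c c' : Fin n → C) (h : SameType L (Sum.elim e c) (Sum.elim (f ∘ e) c')) :
      Realizes c (p ∪ S) ↔ Realizes c' (p ∪ subst f S) := by
    rw [realizes_union, realizes_union, h.realizes_iff rfl hp, h.realizes_iff rfl hS,
      realizes_subst_iff_of_eqOn hfp]
  exact ⟨RankGE.of_sameType hC hκ h key, RankGE.of_sameType hC hκ h.symm fun c c' h =>
    (key c' c h.symm).symm⟩

namespace IsBasedOn

variable {c : Fin n → C} {α : Ordinal.{max u v w}}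

variable (hC : IsHomogeneous D κ (⊤ : L.ElementarySubstructure C)) (hκ : ℵ₀ ≤ κ)
  (hM : IsHomogeneous D ℵ₀ M)

include hC hκ hM

/-- If `c` fails `φ` and yet `φ` keeps rank `α`, then `φ` and its negation split `tp(c, A₀)` at rank
`α`. This would give rank `α + 1`, once clause (b) of the rank is checked. -/
theorem rankGE_union_singleton_iff (h : IsBasedOn D M c A₀ α) {φ : PFormula L C n}
    (hφ : params φ ⊆ M) :
    RankGE D Set.univ α (tp L c A₀ ∪ {φ}) ↔ φ.Realize (Sum.elim id c) := by
  have himp {φ : PFormula L C n} (hφ : params φ ⊆ M) (hr : φ.Realize (Sum.elim id c)) :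
      RankGE D Set.univ α (tp L c A₀ ∪ {φ}) :=
    h.rankGE_union (Set.singleton_subset_iff.2 ⟨hφ, hr⟩) (finite_dom_singleton φ)
  refine ⟨fun h₁ => ?_, himp hφ⟩
  by_contra hn
  refine h.not_rankGE_add_one (rankGE_add_one.2 ⟨⟨φ, Set.subset_univ _, h₁,
    himp ((params_not φ).trans_subset hφ) (Formula.realize_not.2 hn)⟩, fun m a _ => ?_⟩)
  obtain ⟨f, hfM, hf, k, e, hrange, he⟩ := hM.exists_map le_rfl hC.1 h.finite h.subset
    (Set.finite_range a)
  -- Clause (b) for `a`: its copy `f ∘ a` lies in `M`, where `c` itself shows that the type of `c`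
  -- with the copy keeps rank `α`. Invariance of the rank brings this back to `a`.
  refine ⟨T.typeOf (Fin.append c (f ∘ a)), hC.1 _ _ fun _ => trivial, ?_⟩
  have h₂ : RankGE D Set.univ α
      (tp L c A₀ ∪ instType (T.typeOf (Fin.append c (f ∘ a))) (f ∘ a)) := by
    refine h.rankGE_union (subset_tp_iff.2 ⟨(dom_instType_subset _ _).trans ?_,
      realizes_instType_typeOf c (f ∘ a)⟩)
      ((Set.finite_range _).subset (dom_instType_subset _ _))
    rintro _ ⟨i, rfl⟩
    exact hfM _ ⟨i, rfl⟩
  refine RankGE.of_sameType hC hκ he.symm (fun x x' hx => ?_) h₂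
  have hg (i : Fin m) : ∃ j, e j = a i := by
    have : a i ∈ Set.range e := by rw [hrange]; exact Or.inr ⟨i, rfl⟩
    exact this
  choose g hg using hg
  have hga : e ∘ g = a := funext hg
  rw [realizes_union, realizes_union]
  refine and_congr ?_ ?_
  · have hd : dom (tp L c A₀) ⊆ Set.range e := by
      rw [hrange]
      exact (dom_tp_subset c A₀).trans Set.subset_union_left
    rw [hx.symm.realizes_iff rfl hd, realizes_subst_iff_of_eqOn (hf.mono (dom_tp_subset c A₀))]
  · have := hx.comp (Sum.map g id)
    simp only [Sum.elim_comp_map, Function.comp_id, Function.comp_assoc, hga] at this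
    exact this.realizes_instType_iff

/-- This is the tool for all that follows: questions of rank `α` over arbitrary finite parameters
become questions of truth at `c`, after moving the parameters into `M`. -/
theorem exists_map (h : IsBasedOn D M c A₀ α) {E : Set C} (hE : E.Finite) :
    ∃ f : C → C, (∀ x ∈ E, f x ∈ M) ∧
      (∃ (k : ℕ) (e : Fin k → C), Set.range e = A₀ ∪ E ∧ SameType L e (f ∘ e)) ∧
      ∀ S : Set (PFormula L C n), dom S ⊆ A₀ ∪ E →
        (RankGE D Set.univ α (tp L c A₀ ∪ S) ↔ ∀ φ ∈ S, φ.Realize (Sum.elim f c)) := by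
  obtain ⟨f, hfM, hf, k, e, hrange, he⟩ := hM.exists_map le_rfl hC.1 h.finite h.subset hE
  refine ⟨f, hfM, ⟨k, e, hrange, he⟩, fun S hS => ?_⟩
  have hsub : f '' (A₀ ∪ E) ⊆ M := by
    rintro _ ⟨x, hx | hx, rfl⟩
    · rw [hf hx]
      exact h.subset hx
    · exact hfM x hx
  rw [rankGE_union_subst_iff hC hκ he
    (by rw [hrange]; exact (dom_tp_subset c A₀).trans Set.subset_union_left)
    (by rw [hrange]; exact hS) (hf.mono (dom_tp_subset c A₀)), ← realizes_subst_iff]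
  have hdom : dom (subst f S) ⊆ M :=
    (dom_subst_subset f S).trans ((Set.image_mono hS).trans hsub)
  constructor
  · intro hr φ hφ
    exact (h.rankGE_union_singleton_iff hC hκ hM (dom_subset_iff.1 hdom φ hφ)).1
      (hr.mono (Set.union_subset_union_right _ (Set.singleton_subset_iff.2 hφ)))
  · intro hr
    exact h.rankGE_union (subset_tp_iff.2 ⟨hdom, hr⟩)
      (((h.finite.union hE).image f).subset ((dom_subst_subset f S).trans (Set.image_mono hS)))

/-- Completeness, finite satisfiability and membership in `D` each involve finitely many parameters,
and after moving these the free extension is just the type of `c`. -/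
theorem freeExtension_mem_SD (h : IsBasedOn D M c A₀ α) (B : Set C) :
    freeExtension D c A₀ α B ∈ SD D n B := by
  refine ⟨⟨fun φ hφ => hφ.1, fun φ hφ => ?_, fun s hs hfin => ?_⟩, fun m g hg => ?_⟩
  · obtain ⟨f, -, -, hf⟩ := h.exists_map hC hκ hM (finite_params φ)
    have h₁ := hf {φ} (dom_subset_iff.2 (by rintro _ rfl; exact Set.subset_union_right))
    have h₂ := hf {φ.not} (dom_subset_iff.2
      (by rintro _ rfl; rw [params_not]; exact Set.subset_union_right))
    simp only [Set.mem_singleton_iff, forall_eq, Formula.realize_not] at h₁ h₂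
    by_cases hr : φ.Realize (Sum.elim f c)
    · exact Or.inl ⟨hφ, h₁.2 hr⟩
    · exact Or.inr ⟨(params_not φ).trans_subset hφ, h₂.2 hr⟩
  · have hdom : (dom s).Finite :=
      (hfin.biUnion fun φ _ => finite_params φ).subset
        (dom_subset_iff.2 fun φ hφ =>
          Set.subset_biUnion_of_mem (u := fun φ : PFormula L C n => params φ) hφ)
    obtain ⟨f, -, -, hf⟩ := h.exists_map hC hκ hM hdom
    have h₁ := (hf s Set.subset_union_right).2 fun φ hφ => by
      have := (hf {φ} ((dom_mono (Set.singleton_subset_iff.2 hφ)).trans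
        Set.subset_union_right)).1 (hs hφ).2
      exact this φ rfl
    obtain ⟨x, hx⟩ := rankGE_zero.1 (h₁.of_le zero_le)
    exact ⟨x, hx.mono Set.subset_union_right⟩
  · have hE : {x | ∃ i, g i = Sum.inl x}.Finite :=
      ((Set.finite_range g).preimage Sum.inl_injective.injOn).subset fun x hx => hx
    obtain ⟨f, -, -, hf⟩ := h.exists_map hC hκ hM hE
    refine ⟨_, hC.1 m (Sum.elim f c ∘ g) fun _ => trivial, fun ψ => ?_⟩
    have h₁ := hf {(ψ.relabel g : PFormula L C n)} (dom_subset_iff.2 (by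
      rintro _ rfl
      exact (params_relabel_subset (A := {x | ∃ i, g i = Sum.inl x})
        fun i x hi => ⟨i, hi⟩).trans Set.subset_union_right))
    simp only [Set.mem_singleton_iff, forall_eq] at h₁
    rw [Theory.CompleteType.formula_mem_typeOf, ← Formula.realize_relabel, ← h₁]
    exact ⟨fun hψ => ⟨params_relabel_subset hg, hψ⟩, fun hψ => hψ.2⟩

theorem R_freeExtension (h : IsBasedOn D M c A₀ α) {B : Set C} (hB : dom (tp L c A₀) ⊆ B) :
    R D (freeExtension D c A₀ α B) = ((α : WithTop Ordinal.{max u v w}) : RankVal) := by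
  refine le_antisymm ((R_mono (h.tp_subset_freeExtension hB)).trans h.R_tp_base.le)
    (le_R_iff.2 fun q hq hfin => ?_)
  obtain ⟨f, -, -, hf⟩ := h.exists_map hC hκ hM hfin
  have h₁ := (hf q Set.subset_union_right).2 fun φ hφ => by
    have := (hf {φ} ((dom_mono (Set.singleton_subset_iff.2 hφ)).trans
      Set.subset_union_right)).1 (hq hφ).2
    exact this φ rfl
  exact h₁.mono Set.subset_union_right

/-- Every formula of an extension of rank `α` is compatible with `tp(c, A₀)` at rank `α`, so the
extension is contained in the free one; complete types that are comparable are equal. -/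
theorem isStationary (h : IsBasedOn D M c A₀ α) : IsStationary D (tp L c A₀) := by
  intro B hB
  have hSD := h.freeExtension_mem_SD hC hκ hM B
  refine ⟨_, ⟨hSD, h.tp_subset_freeExtension hB, ?_⟩, ?_⟩
  · rw [h.R_freeExtension hC hκ hM hB, h.R_tp_base]
  · rintro q ⟨hq, hsub, hR⟩
    refine hq.1.eq_of_subset hSD.1 fun φ hφ => ⟨hq.1.1 φ hφ, ?_⟩
    refine le_R_iff.1 (h.R_tp_base.symm.trans hR).le _
      (Set.union_subset hsub (Set.singleton_subset_iff.2 hφ)) ?_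
    rw [dom_union_singleton]
    exact (h.finite.subset (dom_tp_subset c A₀)).union (finite_params φ)

end IsBasedOn

theorem IsBasedOn.isBig {c : Fin 1 → C} {α : Ordinal.{max u v w}}
    (hC : IsHomogeneous D κ (⊤ : L.ElementarySubstructure C)) (hκ : ℵ₀ ≤ κ)
    (hM : IsHomogeneous D ℵ₀ M) (h : IsBasedOn D M c A₀ α) (hc : c 0 ∉ M) :
    IsBig κ A₀ (tp L c A₀) := by
  intro B _ _ K hK _
  have hcard : #(((K : Set C) ∪ A₀ : Set C)) < κ :=
    (Cardinal.mk_union_le _ _).trans_lt (Cardinal.add_lt_of_lt hκ hK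
      ((Cardinal.lt_aleph0_iff_set_finite.2 h.finite).trans_le hκ))
  obtain ⟨x, -, hx⟩ := hC.2 _ (fun _ _ => trivial) hcard _
    (h.freeExtension_mem_SD hC hκ hM ((K : Set C) ∪ A₀))
  refine ⟨x, hx.mono fun φ hφ => h.tp_subset_freeExtension
    ((dom_tp_subset c A₀).trans Set.subset_union_right) hφ.1, 0, fun hxK => hc ?_⟩
  -- If the realization `x` of the free extension were in `K`, the free extension would contain the
  -- equation of its variable with `x 0`. Moving `x 0` into `M` would then make `c` an element of
  -- `M`.
  let ψ : L.Formula (Fin 2) := Term.equal (Term.var 0) (Term.var 1)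
  let g : Fin 2 → C ⊕ Fin 1 := ![Sum.inr 0, Sum.inl (x 0)]
  let φ : PFormula L C 1 := ψ.relabel g
  have hφ : params φ ⊆ {x 0} := params_relabel_subset fun i y hi => by
    fin_cases i <;> simp [g] at hi ⊢
    exact hi.symm
  have hreal (f : C → C) (y : Fin 1 → C) : φ.Realize (Sum.elim f y) ↔ y 0 = f (x 0) := by
    simp [φ, ψ, g, Formula.realize_relabel, Formula.realize_equal]
  have hmem : φ ∈ freeExtension D c A₀ α ((K : Set C) ∪ A₀) := by
    rw [(h.freeExtension_mem_SD hC hκ hM _).1.eq_tp hx]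
    exact ⟨hφ.trans (Set.singleton_subset_iff.2 (Or.inl hxK)), (hreal id x).2 rfl⟩
  obtain ⟨f, hfM, -, hf⟩ := h.exists_map hC hκ hM (Set.finite_singleton (x 0))
  have h₁ := (hf {φ} (dom_subset_iff.2 (by
    rintro _ rfl; exact hφ.trans Set.subset_union_right))).1 hmem.2 φ rfl
  rw [(hreal f c).1 h₁]
  exact hfM _ rfl

end Move

/-! ### Minimal rank and regularity. -/

section Regular

variable {L : FirstOrder.Language.{u, v}} {T : L.Theory} {C : Type w} [L.Structure C]
  {D : Diag T} {n : ℕ} [C ⊨ T] [Nonempty C] {χ : Cardinal.{w}}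
  {M N : L.ElementarySubstructure C} {A : Set C}

/-- An element of `N - M` realizes a big stationary type over a finite subset of `M`, of the same
rank as its type over `M`. -/
theorem exists_big_stationary_of_notMem (hχ : ℵ₀ ≤ χ)
    (hC : IsHomogeneous D χ (⊤ : L.ElementarySubstructure C)) (hD : TotallyTranscendental D C)
    (hM : IsHomogeneous D ℵ₀ M) {c : C} (hcN : c ∈ N) (hcM : c ∉ M) :
    ∃ B : Set C, B.Finite ∧ B ⊆ M ∧ tp L (fun _ : Fin 1 => c) B ∈ SD D 1 B ∧
      IsBig χ B (tp L (fun _ : Fin 1 => c) B) ∧ IsStationary D (tp L (fun _ : Fin 1 => c) B) ∧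
      RealizedInDiff (M : Set C) (N : Set C) (tp L (fun _ => c) B) ∧
      R D (tp L (fun _ : Fin 1 => c) B) = R D (tp L (fun _ : Fin 1 => c) (M : Set C)) := by
  obtain ⟨B, hfin, hBM, hR⟩ := exists_finite_R_tp_eq hD (fun _ : Fin 1 => c) (M : Set C)
  obtain ⟨α, hα⟩ := hD.exists_R_eq ⟨_, realizes_tp (fun _ : Fin 1 => c) (M : Set C)⟩
  have hbase : IsBasedOn D M (fun _ : Fin 1 => c) B α := ⟨hfin, hBM, hR.trans hα, hα⟩
  exact ⟨B, hfin, hBM, tp_mem_SD hC.1 _ _, hbase.isBig hC hχ hM hcM,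
    hbase.isStationary hC hχ hM, ⟨c, hcN, hcM, realizes_tp _ _⟩, hR⟩

/-- The exchange argument: if `p` is realized by `c ∈ N - M`, and every element of `N - M` has a
type over `M` whose rank is at least that of `p`, then `p` satisfies the independence condition in
the definition of a regular type. -/
theorem nonfork_union_of_minimal (hχ : ℵ₀ ≤ χ)
    (hC : IsHomogeneous D χ (⊤ : L.ElementarySubstructure C)) (hD : TotallyTranscendental D C)
    (hM : IsHomogeneous D ℵ₀ M) (hN : IsHomogeneous D ℵ₀ N) (hMN : (M : Set C) ⊆ N)
    (hAM : A ⊆ M) {c : C} (hcN : c ∈ N) (hcM : c ∉ M)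
    (hmin : ∀ b ∈ N, b ∉ M →
      R D (tp L (fun _ : Fin 1 => c) A) ≤ R D (tp L (fun _ : Fin 1 => b) (M : Set C)))
    {B : Set C} {a b : Fin 1 → C} (ha : Realizes a (tp L (fun _ : Fin 1 => c) A))
    (hb : Realizes b (tp L (fun _ : Fin 1 => c) A)) (haB : Nonfork D a A B)
    (hbB : ¬ Nonfork D b A B) : Nonfork D a A (B ∪ Set.range b) := by
  obtain ⟨α, hα⟩ := hD.exists_R_eq ⟨_, realizes_tp (fun _ : Fin 1 => c) A⟩
  have hαM : R D (tp L (fun _ : Fin 1 => c) (M : Set C)) = ((α : WithTop Ordinal) : RankVal) :=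
    le_antisymm ((R_mono (tp_mono _ hAM)).trans hα.le) (hα.ge.trans (hmin c hcN hcM))
  have hatp := (isCompleteType_tp (fun _ : Fin 1 => c) A).eq_tp ha
  have hbtp := (isCompleteType_tp (fun _ : Fin 1 => c) A).eq_tp hb
  obtain ⟨A₀, hfin, hA₀, hR⟩ := exists_finite_R_tp_eq hD (fun _ : Fin 1 => c) A
  have hbase : IsBasedOn D M (fun _ : Fin 1 => c) A₀ α :=
    ⟨hfin, hA₀.trans hAM, hR.trans hα, hαM⟩
  have haα : R D (tp L a (A ∪ B)) = ((α : WithTop Ordinal) : RankVal) := by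
    rw [← haB, ← hatp, hα]
  have hbα : R D (tp L b (A ∪ B)) < ((α : WithTop Ordinal) : RankVal) := by
    rw [← hα, hbtp]
    exact (R_mono (tp_mono b Set.subset_union_left)).lt_of_ne fun h => hbB h.symm
  by_contra hna
  have haα' : R D (tp L a (A ∪ (B ∪ Set.range b))) < ((α : WithTop Ordinal) : RankVal) := by
    rw [← hα, hatp]
    exact (R_mono (tp_mono a Set.subset_union_left)).lt_of_ne fun h => hna h.symm
  obtain ⟨q₁, hq₁, hfin₁, hr₁⟩ := exists_not_rankGE_of_R_lt haα'
  obtain ⟨q₂, hq₂, hfin₂, hr₂⟩ := exists_not_rankGE_of_R_lt hbα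
  rw [subset_tp_iff] at hq₁ hq₂
  -- The coordinate of `b` is left out, as its image is chosen later in `N`. Including `A₀` in `E`
  -- makes `hfM` cover the whole range of `e`.
  obtain ⟨f, hfM, ⟨k, e, hrange, he⟩, hf⟩ := hbase.exists_map hC hχ hM
    (E := (A₀ ∪ dom q₁ \ Set.range b) ∪ dom q₂) ((hfin.union hfin₁.sdiff).union hfin₂)
  rw [← Set.union_assoc, ← Set.union_assoc, Set.union_self] at hrange
  have hrangeAB : Set.range e ⊆ A ∪ B := by
    rw [hrange]
    refine Set.union_subset (Set.union_subset (hA₀.trans Set.subset_union_left) ?_) hq₂.1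
    rintro x ⟨hx, hxb⟩
    rcases hq₁.1 hx with h | h | h
    exacts [Or.inl h, Or.inr h, absurd h hxb]
  have heM (i : Fin k) : f (e i) ∈ M := hfM _ (by rw [← hrange]; exact ⟨i, rfl⟩)
  -- Since `a` has rank `α` over `A ∪ B`, each formula it satisfies over `e` is compatible with
  -- `tp(c, A₀)` at rank `α`, so `c` satisfies its image under `f`.
  have hac : SameType L (Sum.elim e a) (Sum.elim (f ∘ e) (fun _ : Fin 1 => c)) := by
    refine sameType_of_forall_imp fun Φ hΦ => ?_
    let φ : PFormula L C 1 := Φ.relabel (Sum.map e id)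
    have hφ : params φ ⊆ Set.range e := params_relabel_subset fun i x hix => by
      rcases i with i | i
      · exact ⟨i, by simpa using hix⟩
      · simp at hix
    have hφr (g : C → C) (x : Fin 1 → C) :
        φ.Realize (Sum.elim g x) ↔ Φ.Realize (Sum.elim (g ∘ e) x) := by
      rw [Formula.realize_relabel, Sum.elim_comp_map, Function.comp_id]
    rw [← hφr]
    refine (hf {φ} ?_).1 (le_R_iff.1 haα.ge _ ?_ ?_) φ rfl
    · refine dom_subset_iff.2 ?_
      rintro _ rfl
      refine hφ.trans (hrange.trans_subset fun x hx => ?_)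
      simp only [Set.mem_union] at hx ⊢
      tauto
    · refine Set.union_subset (fun ψ hψ => ?_) (Set.singleton_subset_iff.2
        ⟨hφ.trans hrangeAB, (hφr id a).2 hΦ⟩)
      have : ψ ∈ tp L a A := hatp ▸ tp_mono _ hA₀ hψ
      exact tp_mono a Set.subset_union_left this
    · rw [dom_union_singleton]
      exact (hfin.subset (dom_tp_subset _ _)).union (finite_params φ)
  obtain ⟨b', hb'N, hb'⟩ := hac.exists_extend hC.1 hN le_rfl
    (by rintro (i | i); exacts [hMN (heM i), hcN]) b
  have heb : SameType L (Sum.elim e b) (Sum.elim (f ∘ e) b') := by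
    have := hb'.comp (Sum.map Sum.inl id)
    simpa only [Sum.elim_comp_map, Sum.elim_comp_inl, Function.comp_id] using this
  have hdom₂ : dom q₂ ⊆ Set.range e := by
    rw [hrange]
    exact Set.subset_union_right
  -- If `b'` is in `M`, the image of `q₁` lies in `tp(c, M)`, which has rank `α`; otherwise the
  -- image of `q₂` lies in `tp(b', M)`, whose rank is at least `α` by minimality. Pulling back the
  -- rank contradicts the choice of `q₁` or `q₂`.
  by_cases hbM : b' 0 ∈ M
  · have heba : SameType L (Sum.elim (Sum.elim e b) a)
        (Sum.elim (Sum.elim (f ∘ e) b') (fun _ : Fin 1 => c)) := by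
      have := hb'.comp (Sum.elim (Sum.elim (Sum.inl ∘ Sum.inl) Sum.inr) (Sum.inl ∘ Sum.inr))
      simpa only [Sum.comp_elim, ← Function.comp_assoc, Sum.elim_comp_inl,
        Sum.elim_comp_inr] using this
    obtain ⟨g, hg⟩ := heb.exists_comp_eq
    have hdom₁ : dom q₁ ⊆ Set.range (Sum.elim e b) := by
      rw [Set.Sum.elim_range, hrange]
      intro x hx
      by_cases hxb : x ∈ Set.range b
      · exact Or.inr hxb
      · exact Or.inl (Or.inl (Or.inr ⟨hx, hxb⟩))
    have hsub : subst g q₁ ⊆ tp L (fun _ : Fin 1 => c) (M : Set C) := by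
      refine subset_tp_iff.2 ⟨(dom_subst_subset g q₁).trans ?_,
        (heba.realizes_iff hg hdom₁).1 hq₁.2⟩
      rintro _ ⟨x, hx, rfl⟩
      obtain ⟨i, rfl⟩ := hdom₁ hx
      rw [show g (Sum.elim e b i) = _ from congrFun hg i]
      rcases i with i | i
      · exact heM i
      · rw [Subsingleton.elim i 0]
        exact hbM
    refine hr₁ (RankGE.of_sameType hC hχ heb.symm (fun x x' hx => ?_)
      (hbase.rankGE hsub ((hfin₁.image g).subset (dom_subst_subset g q₁))))
    exact (hx.symm.realizes_iff hg hdom₁).symm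
  · have hb'eq : b' = fun _ => b' 0 := funext fun i => by rw [Subsingleton.elim i 0]
    have hsub : subst f q₂ ⊆ tp L b' (M : Set C) := by
      refine subset_tp_iff.2 ⟨(dom_subst_subset f q₂).trans ?_,
        (heb.realizes_iff rfl hdom₂).1 hq₂.2⟩
      rintro _ ⟨x, hx, rfl⟩
      obtain ⟨i, rfl⟩ := hdom₂ hx
      exact heM i
    have hle := hα.ge.trans (hmin (b' 0) (hb'N 0) hbM)
    rw [← hb'eq] at hle
    refine hr₂ (RankGE.of_sameType hC hχ he.symm (fun x x' hx => ?_)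
      (le_R_iff.1 hle _ hsub ((hfin₂.image f).subset (dom_subst_subset f q₂))))
    exact (hx.symm.realizes_iff rfl hdom₂).symm

/-- A big stationary type realized in `N - M`, of minimal rank, is regular. -/
theorem isRegular_of_minimal (hχ : ℵ₀ ≤ χ)
    (hC : IsHomogeneous D χ (⊤ : L.ElementarySubstructure C)) (hD : TotallyTranscendental D C)
    (hM : IsHomogeneous D ℵ₀ M) (hN : IsHomogeneous D ℵ₀ N) (hMN : (M : Set C) ⊆ N)
    {p : Set (PFormula L C 1)} (hAM : A ⊆ M) (hp : p ∈ SD D 1 A) (hbig : IsBig χ A p)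
    (hstat : IsStationary D p) (hreal : RealizedInDiff (M : Set C) (N : Set C) p)
    (hmin : ∀ (A' : Set C) (q : Set (PFormula L C 1)), A' ⊆ (M : Set C) →
        q ∈ SD D 1 A' → IsBig χ A' q → IsStationary D q →
        RealizedInDiff (M : Set C) (N : Set C) q → R D p ≤ R D q) :
    IsRegular D χ A p := by
  obtain ⟨c, hcN, hcM, hc⟩ := hreal
  obtain rfl := hp.1.eq_tp hc
  refine ⟨hp, hbig, hstat, Set.subset_univ _, fun B _ a b _ _ ha hb haB hbB =>
    nonfork_union_of_minimal hχ hC hD hM hN hMN hAM hcN hcM (fun b hbN hbM => ?_) ha hb haB hbB⟩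
  obtain ⟨B, -, hBM, hSD, hbig', hstat', hreal', hR⟩ :=
    exists_big_stationary_of_notMem hχ hC hD hM hbN hbM
  exact (hmin B _ hBM hSD hbig' hstat' hreal').trans hR.le

/-- There is a regular type over a finite subset of `M` that is realized in `N - M`. -/
theorem exists_finite_isRegular (hχ : ℵ₀ ≤ χ)
    (hC : IsHomogeneous D χ (⊤ : L.ElementarySubstructure C)) (hD : TotallyTranscendental D C)
    (hM : IsHomogeneous D ℵ₀ M) (hN : IsHomogeneous D ℵ₀ N) (hMN : (M : Set C) ⊂ N) :
    ∃ (A : Set C) (p : Set (PFormula L C 1)), A.Finite ∧ A ⊆ (M : Set C) ∧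
      IsRegular D χ A p ∧ RealizedInDiff (M : Set C) (N : Set C) p := by
  obtain ⟨c₀, hc₀N, hc₀M⟩ := Set.exists_of_ssubset hMN
  -- Minimizing the rank over `M` suffices: a competing type over `A' ⊆ M` realized by `d` has rank
  -- at least that of `tp(d, M)`.
  obtain ⟨c, ⟨hcN, hcM⟩, hcmin⟩ := exists_minimalFor_of_wellFoundedLT
    (fun c : C => c ∈ N ∧ c ∉ M) (fun c => R D (tp L (fun _ : Fin 1 => c) (M : Set C)))
    ⟨c₀, hc₀N, hc₀M⟩
  obtain ⟨B, hfin, hBM, hSD, hbig, hstat, hreal, hR⟩ :=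
    exists_big_stationary_of_notMem hχ hC hD hM hcN hcM
  refine ⟨B, _, hfin, hBM, isRegular_of_minimal hχ hC hD hM hN hMN.subset hBM hSD hbig hstat hreal
    fun A' q hA' hq _ _ ⟨d, hdN, hdM, hd⟩ => ?_, hreal⟩
  rw [hR, hq.1.eq_tp hd]
  refine le_trans ?_ (R_mono (tp_mono _ hA'))
  rcases le_total (R D (tp L (fun _ : Fin 1 => c) (M : Set C)))
    (R D (tp L (fun _ : Fin 1 => d) (M : Set C))) with h | h
  exacts [h, hcmin ⟨hdN, hdM⟩ h]

end Regular

end Diagram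

theorem theorem4 {L : FirstOrder.Language.{u, v}} {T : L.Theory} (D : Diagram.Diag T)
    (C : Type w) [L.Structure C] [C ⊨ T] [Nonempty C]
    (χ : Cardinal.{w}) (hχ : ℵ₀ < χ)
    (hχL : Cardinal.lift.{w} L.card < Cardinal.lift.{max u v} χ)
    (hC : Diagram.IsHomogeneous D χ (⊤ : L.ElementarySubstructure C))
    (hD : Diagram.TotallyTranscendental D C)
    (M N : L.ElementarySubstructure C)
    (hM : Diagram.IsHomogeneous D ℵ₀ M) (hN : Diagram.IsHomogeneous D ℵ₀ N)
    (hMN : (M : Set C) ⊂ (N : Set C)) :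
    (∃ (A : Set C) (p : Set (Diagram.PFormula L C 1)), A.Finite ∧ A ⊆ (M : Set C) ∧
      Diagram.IsRegular D χ A p ∧ Diagram.RealizedInDiff (M : Set C) (N : Set C) p) ∧
    (∀ (A : Set C) (p : Set (Diagram.PFormula L C 1)), A ⊆ (M : Set C) →
      p ∈ Diagram.SD D 1 A → Diagram.IsBig χ A p → Diagram.IsStationary D p →
      Diagram.RealizedInDiff (M : Set C) (N : Set C) p →
      (∀ (A' : Set C) (q : Set (Diagram.PFormula L C 1)), A' ⊆ (M : Set C) →
        q ∈ Diagram.SD D 1 A' → Diagram.IsBig χ A' q → Diagram.IsStationary D q →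
        Diagram.RealizedInDiff (M : Set C) (N : Set C) q → Diagram.R D p ≤ Diagram.R D q) →
      Diagram.IsRegular D χ A p) :=
  ⟨Diagram.exists_finite_isRegular hχ.le hC hD hM hN hMN,
    fun _ _ hAM hp hbig hstat hreal hmin =>
      Diagram.isRegular_of_minimal hχ.le hC hD hM hN hMN.subset hAM hp hbig hstat hreal hmin⟩
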